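/- Let $(X,Y)$ be a dual pair of real vector spaces with separating bilinear pairing $\langle\cdot,\cdot\rangle$, where $X$ carries a locally convex topology compatible with the pairing (its continuous linear functionals are exactly the maps $\langle x^*,\cdot\rangle$, $x^*\in Y$). Let $\Phi:X\to\mathbb{R}\cup\{+\infty\}$ be proper, convex and lower semicontinuous, and suppose that $\Phi$ is epi-pointed: its conjugate $\Phi^*(x^*)=\sup_{x\in X}(\langle x^*,x\rangle-\Phi(x))$ is finite and continuous for the Mackey topology $\tau(Y,X)$ at some point of $Y$. For $x\in\operatorname{dom}\Phi=\{\Phi<+\infty\}$ let $\partial\Phi(x)=\{x^*\in Y:\langle x^*,u-x\rangle\le\Phi(u)-\Phi(x)\ \forall u\in X\}$, and let $\partial\Phi(x)=\emptyset$ otherwise. Let $\bar x\in\operatorname{dom}\Phi$, let $[\Phi\le\Phi(\bar x)]=\{x\in X:\Phi(x)\le\Phi(\bar x)\}$, and let $$\mathrm N_{[\Phi\le\Phi(\bar x)]}(\bar x)=\{x^*\in Y:\langle x^*,x-\bar x\rangle\le 0\ \text{ for all } x\in[\Phi\le\Phi(\bar x)]\}$$ be the normal cone. Then, with upper limits taken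 in the weak* topology $\sigma(Y,X)$, $$\mathrm N_{[\Phi\le\Phi(\bar x)]}(\bar x)=\limsup_{\substack{x\to\bar x,\ \mu\ge0\\ \mu(\Phi(x)-\Phi(\bar x))\to0\\ \mu\langle\cdot,x-\bar x\rangle\to0}}\mu\,\partial\Phi(x)=\limsup_{\substack{\mu\ge0,\ \mu(\Phi(x)-\Phi(\bar x))\to0\\ \mu\langle\cdot,x-\bar x\rangle\to0}}\mu\,\partial\Phi(x).$$ Here the first upper limit is the set of all $\xi\in Y$ such that for every weak* neighbourhood $W$ of $\xi$, every neighbourhood $U$ of $\bar x$ and every $\varepsilon>0$ there are $x\in U$, $\mu\ge0$ and $x^*\in\partial\Phi(x)$ with $|\mu(\Phi(x)-\Phi(\bar x))|<\varepsilon$, $|\mu\langle x^*,x-\bar x\rangle|<\varepsilon$ and $\mu x^*\in W$; the second is defined in the same way with the requirement $x\in U$ omitted. In particular, each $\xi\in\mathrm N_{[\Phi\le\Phi(\bar x)]}(\bar x)$ is the weak* limit of a net $(\mu_ix_i^*)$ with $\mu_i\ge0$, $x_i^*\in\partial\Phi(x_i)$, $x_i\to\bar x$, $\mu_i(\Phi(x_i)-\Phi(\bar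 x))\to0$ and $\mu_i\langle x_i^*,x_i-\bar x\rangle\to0$. -/

import Mathlib

open Set Filter Topology

universe u v

noncomputable section

namespace DualPair

section Topologies

variable {X : Type u} {Y : Type v} [AddCommGroup X] [Module ℝ X] [AddCommGroup Y] [Module ℝ Y]

/-- The weak topology `σ(X, Y)` of the pairing `B`: the coarsest topology on `X` making all
`x ↦ B x y` continuous. The weak* topology `σ(Y, X)` on `Y` is `weakTopology B.flip`. -/
abbrev weakTopology (B : X →ₗ[ℝ] Y →ₗ[ℝ] ℝ) : TopologicalSpace X :=
  TopologicalSpace.induced (fun (x : X) (y : Y) => B x y) Pi.topologicalSpace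

/-- The absolutely convex `σ(X, Y)`-compact subsets of `X`. -/
def absConvexWeaklyCompact (B : X →ₗ[ℝ] Y →ₗ[ℝ] ℝ) : Set (Set X) :=
  {K | AbsConvex ℝ K ∧ @IsCompact X (weakTopology B) K}

/-- The Mackey topology `τ(Y, X)` on `Y`: uniform convergence on the absolutely convex
`σ(X, Y)`-compact subsets of `X`. -/
abbrev mackeyTopology (B : X →ₗ[ℝ] Y →ₗ[ℝ] ℝ) : TopologicalSpace Y :=
  TopologicalSpace.induced
    (fun y : Y => UniformOnFun.ofFun (absConvexWeaklyCompact B) (fun x : X => B x y))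
    inferInstance

/-- The topology of `X` is compatible with the pairing `B`: the continuous linear functionals
on `X` are exactly the maps `x ↦ B x y` with `y : Y`. -/
def IsCompatible [TopologicalSpace X] (B : X →ₗ[ℝ] Y →ₗ[ℝ] ℝ) : Prop :=
  ∀ f : X →ₗ[ℝ] ℝ, Continuous f ↔ ∃ y : Y, ∀ x : X, f x = B x y

end Topologies

section Functions

variable {X : Type u} {Y : Type v} [AddCommGroup X] [Module ℝ X] [AddCommGroup Y] [Module ℝ Y]

/-- The effective domain of `Φ`. -/
def dom (Φ : X → EReal) : Set X := {x | Φ x < ⊤}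

/-- The epigraph of `Φ`, a subset of `X × ℝ`. -/
def epi (Φ : X → EReal) : Set (X × ℝ) := {p | Φ p.1 ≤ (p.2 : EReal)}

/-- `Φ ∈ Γ₀(X)`: `Φ` takes values in `ℝ ∪ {+∞}`, is not identically `+∞`, and its epigraph is
convex and closed. -/
structure IsGammaZero [TopologicalSpace X] (Φ : X → EReal) : Prop where
  ne_bot : ∀ x, Φ x ≠ ⊥
  dom_nonempty : (dom Φ).Nonempty
  convex_epi : Convex ℝ (epi Φ)
  isClosed_epi : IsClosed (epi Φ)

/-- The Fenchel conjugate `Φ*(y) = sup_x (⟨y, x⟩ - Φ x)`. -/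
def conj (B : X →ₗ[ℝ] Y →ₗ[ℝ] ℝ) (Φ : X → EReal) (y : Y) : EReal :=
  ⨆ x : X, ((B x y : ℝ) : EReal) - Φ x

/-- `Φ` is epi-pointed: its conjugate is finite and Mackey-continuous at some point. -/
def EpiPointed (B : X →ₗ[ℝ] Y →ₗ[ℝ] ℝ) (Φ : X → EReal) : Prop :=
  ∃ y₀ : Y, conj B Φ y₀ ≠ ⊥ ∧ conj B Φ y₀ ≠ ⊤ ∧
    @ContinuousAt Y EReal (mackeyTopology B) _ (conj B Φ) y₀

/-- The subdifferential `∂Φ(x)`, which is empty when `x` is outside the domain. -/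
def subdiff (B : X →ₗ[ℝ] Y →ₗ[ℝ] ℝ) (Φ : X → EReal) (x : X) : Set Y :=
  {y | x ∈ dom Φ ∧ ∀ u : X, ((B (u - x) y : ℝ) : EReal) ≤ Φ u - Φ x}

/-- The sublevel set `[Φ ≤ c]`. -/
def sublevel (Φ : X → EReal) (c : EReal) : Set X := {x | Φ x ≤ c}

/-- The normal cone to `S` at `x₀`. -/
def normalCone (B : X →ₗ[ℝ] Y →ₗ[ℝ] ℝ) (S : Set X) (x₀ : X) : Set Y :=
  {y | ∀ x ∈ S, B (x - x₀) y ≤ 0}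

/-- The Painlevé–Kuratowski upper limit of a multifunction `M` along a filter `l`, for the
topology `t` on the target. -/
def upperLimit {U : Type*} {V : Type*} (t : TopologicalSpace V) (l : Filter U)
    (M : U → Set V) : Set V :=
  {v | ∀ W ∈ @nhds V t v, ∀ Z ∈ l, ∃ u ∈ Z, (M u ∩ W).Nonempty}

/-- The multifunction of the parameters `(x, μ, x*)` whose value is `{μ x*}` if `x* ∈ ∂Φ(x)`
and is empty otherwise. -/
def scaledSubdiff (B : X →ₗ[ℝ] Y →ₗ[ℝ] ℝ) (Φ : X → EReal) (p : X × ℝ × Y) : Set Y :=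
  {z | p.2.2 ∈ subdiff B Φ p.1 ∧ z = p.2.1 • p.2.2}

/-- The filter of the parameters `(x, μ, x*)` with `x ∈ dom Φ` and `μ ≥ 0` for the convergences
`μ (Φ x - Φ x₀) → 0` and `μ ⟨x*, x - x₀⟩ → 0` (with `x₀ ∈ dom Φ`). -/
def paramFilter (B : X →ₗ[ℝ] Y →ₗ[ℝ] ℝ) (Φ : X → EReal) (x₀ : X) : Filter (X × ℝ × Y) :=
  𝓟 {p | p.1 ∈ dom Φ ∧ 0 ≤ p.2.1} ⊓
    comap (fun p : X × ℝ × Y => p.2.1 * ((Φ p.1).toReal - (Φ x₀).toReal)) (𝓝 0) ⊓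
    comap (fun p : X × ℝ × Y => p.2.1 * B (p.1 - x₀) p.2.2) (𝓝 0)

/-- The same filter with the additional convergence `x → x₀`. -/
def paramFilterAt [TopologicalSpace X] (B : X →ₗ[ℝ] Y →ₗ[ℝ] ℝ) (Φ : X → EReal) (x₀ : X) :
    Filter (X × ℝ × Y) :=
  comap (fun p : X × ℝ × Y => p.1) (𝓝 x₀) ⊓ paramFilter B Φ x₀

end Functions

end DualPair

end

/-! One inclusion is the subgradient inequality multiplied by `μ`; it needs no convergence of `x`.
Hence it suffices to put the normal cone inside the upper limit with `x → x₀`, the smallest of the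
three sets.

For a normal vector `ξ`, duality first gives approximate multipliers: the pairs `(η, r)` with `η` an
`r`-subgradient of some `l Φ` at `x₀`, `l > 0`, form a convex set with `(ξ, 0)` in its weak* closure
(`mem_closure_approxMultipliers`). Otherwise a separating functional gives a direction `a` in which
`Φ` does not increase from `x₀`, since `Φ` is the supremum of its affine minorants; this contradicts
normality.

Approximate subgradients are then replaced by exact ones at nearby points
(`exists_subgradient_near`). Weak compactness takes the place of completeness in the
Brøndsted–Rockafellar argument: epi-pointedness puts the sublevel sets of some `Φ - y₀` in weakly
compact sets. Adding a small multiple `t (Φ - y₀)` to `l Φ - η`, and a small continuous seminorm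
centred at `x₀`, yields a function that attains its minimum. The minimizer is near `x₀`, and
Fermat's rule provides a subgradient there. -/

namespace DualPair

/-! ### The weak topology of a pairing -/

section WeakTopology

variable {X : Type u} {Y : Type v} [AddCommGroup X] [Module ℝ X] [AddCommGroup Y] [Module ℝ Y]
  {B : X →ₗ[ℝ] Y →ₗ[ℝ] ℝ}

theorem continuous_weakTopology (B : X →ₗ[ℝ] Y →ₗ[ℝ] ℝ) (y : Y) :
    Continuous[weakTopology B, inferInstance] fun x => B x y :=
  WeakBilin.eval_continuous B y

theorem isClosed_weakTopology_of_separated {C : Set X}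
    (h : ∀ x ∉ C, ∃ (y : Y) (r : ℝ), B x y < r ∧ ∀ z ∈ C, r ≤ B z y) :
    IsClosed[weakTopology B] C := by
  let := weakTopology B
  rw [← isOpen_compl_iff, isOpen_iff_mem_nhds]
  intro x hx
  obtain ⟨y, r, hxr, hr⟩ := h x hx
  have hmem : {z : X | B z y < r} ∈ 𝓝 x :=
    (isOpen_lt (continuous_weakTopology B y) continuous_const).mem_nhds hxr
  exact mem_of_superset hmem fun z hz hzC => (not_le.2 hz) (hr z hzC)

theorem weakTopology_isTopologicalAddGroup (B : X →ₗ[ℝ] Y →ₗ[ℝ] ℝ) :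
    @IsTopologicalAddGroup X (weakTopology B) _ :=
  inferInstanceAs (IsTopologicalAddGroup (WeakBilin B))

theorem weakTopology_continuousSMul (B : X →ₗ[ℝ] Y →ₗ[ℝ] ℝ) :
    @ContinuousSMul ℝ X _ _ (weakTopology B) :=
  inferInstanceAs (ContinuousSMul ℝ (WeakBilin B))

theorem weakTopology_locallyConvexSpace (B : X →ₗ[ℝ] Y →ₗ[ℝ] ℝ) :
    @LocallyConvexSpace ℝ X _ _ _ _ (weakTopology B) :=
  inferInstanceAs (LocallyConvexSpace ℝ (WeakBilin B))

theorem weakTopology_exists_eq (B : X →ₗ[ℝ] Y →ₗ[ℝ] ℝ) (f : X →ₗ[ℝ] ℝ)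
    (hf : Continuous[weakTopology B, inferInstance] f) : ∃ y : Y, ∀ x, f x = B x y := by
  obtain ⟨y, hy⟩ := LinearMap.dualEmbedding_surjective B ⟨f, hf⟩
  exact ⟨y, fun x => (DFunLike.congr_fun hy x).symm⟩

theorem exists_finset_subset_of_mem_nhds_weakTopology {x : X} {W : Set X}
    (hW : W ∈ @nhds X (weakTopology B) x) :
    ∃ (s : Finset Y) (δ : ℝ), 0 < δ ∧ ∀ z, (∀ y ∈ s, |B z y - B x y| < δ) → z ∈ W := by
  rw [nhds_induced, nhds_pi, Filter.mem_comap] at hW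
  obtain ⟨V, hV, hVW⟩ := hW
  rw [Filter.mem_pi] at hV
  obtain ⟨I, hI, t, ht, htV⟩ := hV
  choose δ hδ hδt using fun y => Metric.mem_nhds_iff.1 (ht y)
  obtain ⟨d, hd, hdI⟩ : ∃ d : ℝ, 0 < d ∧ ∀ y ∈ hI.toFinset, d ≤ δ y := by
    rcases hI.toFinset.eq_empty_or_nonempty with h | h
    · exact ⟨1, one_pos, by simp [h]⟩
    · exact ⟨hI.toFinset.inf' h δ, (Finset.lt_inf'_iff h).2 fun y _ => hδ y,
        fun y hy => Finset.inf'_le _ hy⟩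
  refine ⟨hI.toFinset, d, hd, fun z hz => hVW (htV fun y hy => hδt y ?_)⟩
  have hy' := hI.mem_toFinset.2 hy
  rw [Metric.mem_ball, Real.dist_eq]
  exact (hz y hy').trans_le (hdI y hy')

end WeakTopology

/-! ### Real-valued forms of the definitions, and affine minorants -/

section Basic

variable {X : Type u} {Y : Type v} [AddCommGroup X] [Module ℝ X] [AddCommGroup Y] [Module ℝ Y]
  [TopologicalSpace X] {B : X →ₗ[ℝ] Y →ₗ[ℝ] ℝ} {Φ : X → EReal}

theorem IsCompatible.continuous_pairing (hcomp : IsCompatible B) (y : Y) :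
    Continuous fun x => B x y :=
  (hcomp (B.flip y)).2 ⟨y, fun _ => rfl⟩

theorem IsGammaZero.coe_toReal (hΦ : IsGammaZero Φ) {x : X} (hx : x ∈ dom Φ) :
    ((Φ x).toReal : EReal) = Φ x :=
  EReal.coe_toReal (ne_of_lt hx) (hΦ.ne_bot x)

theorem IsGammaZero.mem_epi_iff (hΦ : IsGammaZero Φ) {x : X} {r : ℝ} :
    (x, r) ∈ epi Φ ↔ x ∈ dom Φ ∧ (Φ x).toReal ≤ r := by
  constructor
  · intro h
    have h' : Φ x ≤ (r : EReal) := h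
    have hx : x ∈ dom Φ := lt_of_le_of_lt h' (EReal.coe_lt_top r)
    refine ⟨hx, ?_⟩
    rw [← hΦ.coe_toReal hx] at h'
    exact EReal.coe_le_coe_iff.1 h'
  · rintro ⟨hx, h⟩
    change Φ x ≤ (r : EReal)
    rw [← hΦ.coe_toReal hx]
    exact EReal.coe_le_coe_iff.2 h

theorem IsGammaZero.mem_sublevel_iff (hΦ : IsGammaZero Φ) {x₀ : X} (hx₀ : x₀ ∈ dom Φ) {x : X} :
    x ∈ sublevel Φ (Φ x₀) ↔ x ∈ dom Φ ∧ (Φ x).toReal ≤ (Φ x₀).toReal := by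
  rw [← hΦ.mem_epi_iff]
  change Φ x ≤ Φ x₀ ↔ Φ x ≤ ((Φ x₀).toReal : EReal)
  rw [hΦ.coe_toReal hx₀]

theorem IsGammaZero.mem_subdiff_iff (hΦ : IsGammaZero Φ) {x : X} {y : Y} :
    y ∈ subdiff B Φ x ↔
      x ∈ dom Φ ∧ ∀ u ∈ dom Φ, B (u - x) y ≤ (Φ u).toReal - (Φ x).toReal := by
  refine and_congr_right fun hx => ⟨fun h u hu => ?_, fun h u => ?_⟩
  · have := h u
    rw [← hΦ.coe_toReal hu, ← hΦ.coe_toReal hx, ← EReal.coe_sub] at this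
    exact EReal.coe_le_coe_iff.1 this
  · by_cases hu : u ∈ dom Φ
    · rw [← hΦ.coe_toReal hu, ← hΦ.coe_toReal hx, ← EReal.coe_sub]
      exact EReal.coe_le_coe_iff.2 (h u hu)
    · have : Φ u = ⊤ := not_lt_top_iff.1 hu
      rw [this, ← hΦ.coe_toReal hx, EReal.top_sub_coe]
      exact le_top

theorem IsGammaZero.conj_le_coe_iff (hΦ : IsGammaZero Φ) {y : Y} {r : ℝ} :
    conj B Φ y ≤ (r : EReal) ↔ ∀ x ∈ dom Φ, B x y - (Φ x).toReal ≤ r := by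
  refine iSup_le_iff.trans ⟨fun h x hx => ?_, fun h x => ?_⟩
  · have := h x
    rw [← hΦ.coe_toReal hx, ← EReal.coe_sub] at this
    exact EReal.coe_le_coe_iff.1 this
  · by_cases hx : x ∈ dom Φ
    · rw [← hΦ.coe_toReal hx, ← EReal.coe_sub]
      exact EReal.coe_le_coe_iff.2 (h x hx)
    · have : Φ x = ⊤ := not_lt_top_iff.1 hx
      rw [this, EReal.sub_top]
      exact bot_le

theorem IsGammaZero.convexOn_toReal (hΦ : IsGammaZero Φ) :
    ConvexOn ℝ (dom Φ) fun x => (Φ x).toReal := by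
  have key : ∀ x ∈ dom Φ, ∀ y ∈ dom Φ, ∀ a b : ℝ, 0 ≤ a → 0 ≤ b → a + b = 1 →
      a • x + b • y ∈ dom Φ ∧
        (Φ (a • x + b • y)).toReal ≤ a • (Φ x).toReal + b • (Φ y).toReal := by
    intro x hx y hy a b ha hb hab
    have := hΦ.convex_epi (hΦ.mem_epi_iff.2 ⟨hx, le_rfl⟩) (hΦ.mem_epi_iff.2 ⟨hy, le_rfl⟩)
      ha hb hab
    exact hΦ.mem_epi_iff.1 this
  exact ⟨fun x hx y hy a b ha hb hab => (key x hx y hy a b ha hb hab).1,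
    fun x hx y hy a b ha hb hab => (key x hx y hy a b ha hb hab).2⟩

/-- Mazur's theorem: a closed convex set is cut out by continuous functionals, and by compatibility
these all come from `Y`. -/
theorem isClosed_weakTopology_of_convex [IsTopologicalAddGroup X] [ContinuousSMul ℝ X]
    [LocallyConvexSpace ℝ X] (hcomp : IsCompatible B) {C : Set X} (hC : Convex ℝ C)
    (hCc : IsClosed C) : IsClosed[weakTopology B] C := by
  refine isClosed_weakTopology_of_separated fun x hx => ?_
  obtain ⟨f, r, hf, hfC⟩ := geometric_hahn_banach_point_closed hC hCc hx
  obtain ⟨y, hy⟩ := (hcomp f.toLinearMap).1 f.continuous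
  refine ⟨y, r, (hy x).symm.trans_lt hf, fun z hz => ?_⟩
  exact (hfC z hz).le.trans_eq (hy z)

/-- A closed convex function with an affine minorant is the supremum of its affine minorants. -/
theorem IsGammaZero.exists_affine_minorant [IsTopologicalAddGroup X] [ContinuousSMul ℝ X]
    [LocallyConvexSpace ℝ X] (hcomp : IsCompatible B) (hΦ : IsGammaZero Φ) {y₀ : Y} {c₀ : ℝ}
    (h₀ : ∀ u ∈ dom Φ, B u y₀ - c₀ ≤ (Φ u).toReal) {x : X} {r : ℝ} (hx : (x, r) ∉ epi Φ) :
    ∃ (y : Y) (c : ℝ), (∀ u ∈ dom Φ, B u y - c ≤ (Φ u).toReal) ∧ r < B x y - c := by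
  obtain ⟨f, α, hf, hfE⟩ :=
    geometric_hahn_banach_point_closed hΦ.convex_epi hΦ.isClosed_epi hx
  obtain ⟨w, hw⟩ := (hcomp (f.comp (ContinuousLinearMap.inl ℝ X ℝ)).toLinearMap).1
    (f.comp (ContinuousLinearMap.inl ℝ X ℝ)).continuous
  set s := f (0, 1) with hs
  have hfe : ∀ (u : X) (t : ℝ), f (u, t) = B u w + t * s := by
    intro u t
    have h1 : (u, t) = ContinuousLinearMap.inl ℝ X ℝ u + t • ((0, 1) : X × ℝ) := by
      ext <;> simp
    rw [h1, map_add, map_smul, ← hs, ← hw u]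
    rfl
  have hE : ∀ u ∈ dom Φ, ∀ t, (Φ u).toReal ≤ t → α < B u w + t * s := by
    intro u hu t ht
    rw [← hfe]
    exact hfE _ (hΦ.mem_epi_iff.2 ⟨hu, ht⟩)
  rw [hfe] at hf
  obtain ⟨u₀, hu₀⟩ := hΦ.dom_nonempty
  have hs0 : 0 ≤ s := by
    by_contra hneg
    push Not at hneg
    have h1 := hE u₀ hu₀ (max (Φ u₀).toReal ((B u₀ w - α) / (-s))) (le_max_left _ _)
    have h2 : (B u₀ w - α) / (-s) ≤ max (Φ u₀).toReal ((B u₀ w - α) / (-s)) := le_max_right _ _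
    rw [div_le_iff₀ (by linarith)] at h2
    linarith
  -- If `s = 0` the hyperplane is vertical and only separates `x` from `dom Φ`. Adding `n (α - ⟨w,
  -- ·⟩)`, which is negative on `dom Φ` and positive at `x`, to the given minorant lifts its value
  -- at `x` above `r`. If `s > 0`, the hyperplane itself is the graph of the required minorant.
  rcases hs0.eq_or_lt with h0 | hpos
  · rw [← h0] at hf hE
    simp only [mul_zero, add_zero] at hf hE
    obtain ⟨n, hn⟩ : ∃ n : ℝ, 0 ≤ n ∧ r < B x y₀ - c₀ + n * (α - B x w) := by
      refine ⟨(|r - (B x y₀ - c₀)| + 1) / (α - B x w), by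
        have := sub_pos.2 hf; positivity, ?_⟩
      rw [div_mul_cancel₀ _ (sub_pos.2 hf).ne']
      linarith [le_abs_self (r - (B x y₀ - c₀))]
    refine ⟨y₀ - n • w, c₀ - n * α, fun u hu => ?_, ?_⟩
    · have h1 := hE u hu _ le_rfl
      have h2 := mul_le_mul_of_nonneg_left h1.le hn.1
      have h3 := h₀ u hu
      simp only [map_sub, map_smul, smul_eq_mul]
      linarith
    · have := hn.2
      simp only [map_sub, map_smul, smul_eq_mul]
      linarith
  · refine ⟨(-s⁻¹) • w, -α / s, fun u hu => ?_, ?_⟩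
    · have h1 := hE u hu _ le_rfl
      have h2 : (α - B u w) / s ≤ (Φ u).toReal := by
        rw [div_le_iff₀ hpos]; linarith
      simp only [map_smul, smul_eq_mul]
      calc _ = (α - B u w) / s := by field_simp; ring
        _ ≤ _ := h2
    · have h2 : r < (α - B x w) / s := by
        rw [lt_div_iff₀ hpos]; linarith
      simp only [map_smul, smul_eq_mul]
      calc _ < (α - B x w) / s := h2
        _ = _ := by field_simp; ring

end Basic

/-! ### Mackey neighbourhoods and weak compactness of sublevel sets -/

section Compactness

open scoped Pointwise

variable {X : Type u} {Y : Type v} [AddCommGroup X] [Module ℝ X] [AddCommGroup Y] [Module ℝ Y]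
  {B : X →ₗ[ℝ] Y →ₗ[ℝ] ℝ} {Φ : X → EReal}

/-- `K + L` contains both sets because each contains `0`. Directedness allows a basic Mackey
neighbourhood to be described by a single compact set. -/
theorem directedOn_absConvexWeaklyCompact (B : X →ₗ[ℝ] Y →ₗ[ℝ] ℝ) :
    DirectedOn (· ⊆ ·) (absConvexWeaklyCompact B) := by
  intro K hK L hL
  rcases K.eq_empty_or_nonempty with rfl | hKne
  · exact ⟨L, hL, empty_subset _, subset_rfl⟩
  rcases L.eq_empty_or_nonempty with rfl | hLne
  · exact ⟨K, hK, subset_rfl, empty_subset _⟩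
  have hK0 : (0 : X) ∈ K := hK.1.1.zero_mem hKne
  have hL0 : (0 : X) ∈ L := hL.1.1.zero_mem hLne
  refine ⟨K + L, ⟨⟨hK.1.1.add hL.1.1, hK.1.2.add hL.1.2⟩, ?_⟩,
    fun x hx => ⟨x, hx, 0, hL0, add_zero x⟩, fun x hx => ⟨0, hK0, x, hx, zero_add x⟩⟩
  let := weakTopology B
  have := weakTopology_isTopologicalAddGroup B
  exact IsCompact.add hK.2 hL.2

theorem exists_absConvex_subset_of_mem_nhds_mackeyTopology {y₀ : Y} {V : Set Y}
    (hV : V ∈ @nhds Y (mackeyTopology B) y₀) :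
    ∃ K ∈ absConvexWeaklyCompact B, ∃ δ : ℝ, 0 < δ ∧
      ∀ y, (∀ k ∈ K, |B k (y - y₀)| < δ) → y ∈ V := by
  rw [nhds_induced, Filter.mem_comap] at hV
  obtain ⟨T, hT, hTV⟩ := hV
  have hne : (absConvexWeaklyCompact B).Nonempty :=
    ⟨∅, ⟨balanced_empty, convex_empty⟩, @isCompact_empty X (weakTopology B)⟩
  obtain ⟨⟨K, δ⟩, ⟨hK, hδ⟩, hKT⟩ := (UniformOnFun.hasBasis_nhds_of_basis X ℝ
    (absConvexWeaklyCompact B) _ hne (directedOn_absConvexWeaklyCompact B)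
    Metric.uniformity_basis_dist).mem_iff.1 hT
  refine ⟨K, hK, δ, hδ, fun y hy => hTV (hKT fun k hk => ?_)⟩
  have := hy k hk
  rw [map_sub] at this
  simpa [Real.dist_eq] using! this

/-- A point outside a multiple of an absolutely convex weakly compact set is detected by an element
of a dilated polar. -/
theorem mem_smul_of_polar_bound {K : Set X} (hK : K ∈ absConvexWeaklyCompact B)
    (hB : B.SeparatingLeft) (hKne : K.Nonempty) {c δ M : ℝ} (hδ : 0 < δ) (hc : 0 < c)
    (hM : M < δ * c) {x : X}
    (hx : ∀ y, (∀ k ∈ K, |B k y| < δ) → B x y ≤ M) : x ∈ c • K := by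
  by_contra hxK
  let := weakTopology B
  have := weakTopology_isTopologicalAddGroup B
  have := weakTopology_continuousSMul B
  have := weakTopology_locallyConvexSpace B
  -- Separation of points makes the weak topology Hausdorff, so the compact set `c • K` is closed
  -- and can be separated from `x`.
  have : T2Space X := by
    refine T2Space.of_injective_continuous (f := fun (x : X) (y : Y) => B x y) ?_
      continuous_induced_dom
    intro a b hab
    have h0 := hB (a - b) fun y => by
      have := congrFun hab y
      simp only at this
      simp [this]
    exact sub_eq_zero.1 h0
  have hcomp : IsCompact (c • K) := IsCompact.smul c hK.2
  obtain ⟨f, α, hf, hfx⟩ :=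
    geometric_hahn_banach_closed_point (hK.1.2.smul c) hcomp.isClosed hxK
  obtain ⟨w, hw⟩ := weakTopology_exists_eq B f.toLinearMap f.continuous
  have hw' : ∀ z, f z = B z w := hw
  have hα : 0 < α := by
    have := hf (c • 0) (smul_mem_smul_set (hK.1.1.zero_mem hKne))
    simpa using this
  have hKw : ∀ k ∈ K, |B k w| < α / c := by
    have : ∀ k ∈ K, B k w < α / c := by
      intro k hk
      have := hf (c • k) (smul_mem_smul_set hk)
      rw [hw', map_smul, LinearMap.smul_apply, smul_eq_mul] at this
      rw [lt_div_iff₀ hc]; linarith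
    intro k hk
    refine abs_lt.2 ⟨?_, this k hk⟩
    have h1 := this (-k) (hK.1.1.neg_mem_iff.2 hk)
    rw [map_neg, LinearMap.neg_apply] at h1
    linarith
  -- Rescaled by this factor, `w` stays below `δ` on `K`, while its value at `x` exceeds `δ * c >
  -- M`.
  have hs : 0 < δ * c / α := by positivity
  have h1 := hx ((δ * c / α) • w) fun k hk => by
    rw [map_smul, smul_eq_mul, abs_mul, abs_of_pos hs]
    calc _ < δ * c / α * (α / c) := mul_lt_mul_of_pos_left (hKw k hk) hs
      _ = δ := by field_simp
  rw [map_smul, smul_eq_mul] at h1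
  rw [hw'] at hfx
  have h2 : δ * c / α * α < δ * c / α * B x w := mul_lt_mul_of_pos_left hfx hs
  rw [div_mul_cancel₀ _ hα.ne'] at h2
  linarith

variable [TopologicalSpace X]

/-- Moreau: if the conjugate is Mackey-continuous at `y₀`, then the sublevel sets of `Φ - y₀` are
contained in weakly compact sets. -/
theorem IsGammaZero.exists_compact_of_epiPointed (hB : B.SeparatingLeft) (hΦ : IsGammaZero Φ)
    (hepi : EpiPointed B Φ) :
    ∃ (y₀ : Y) (c₀ : ℝ), (∀ u ∈ dom Φ, B u y₀ - c₀ ≤ (Φ u).toReal) ∧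
      ∀ c : ℝ, ∃ K : Set X, @IsCompact X (weakTopology B) K ∧
        ∀ x ∈ dom Φ, (Φ x).toReal - B x y₀ ≤ c → x ∈ K := by
  obtain ⟨y₀, hbot, htop, hcont⟩ := hepi
  have hr : ((conj B Φ y₀).toReal : EReal) = conj B Φ y₀ := EReal.coe_toReal htop hbot
  set r := (conj B Φ y₀).toReal
  refine ⟨y₀, r, fun u hu => ?_, fun c => ?_⟩
  · have := (hΦ.conj_le_coe_iff (B := B)).1 hr.ge u hu
    linarith
  have hlt : conj B Φ y₀ < ((r + 1 : ℝ) : EReal) := by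
    rw [← hr]; exact EReal.coe_lt_coe_iff.2 (lt_add_one r)
  have hmem : {y | conj B Φ y < ((r + 1 : ℝ) : EReal)} ∈ @nhds Y (mackeyTopology B) y₀ :=
    hcont (Iio_mem_nhds hlt)
  obtain ⟨K, hK, δ, hδ, hKV⟩ := exists_absConvex_subset_of_mem_nhds_mackeyTopology hmem
  -- For empty `K` the polar condition is vacuous, so `{0}` serves equally well.
  wlog hKne : K.Nonempty generalizing K
  · refine this {0} ⟨⟨?_, convex_singleton 0⟩, @isCompact_singleton X (weakTopology B) 0⟩
      (fun y _ => hKV y fun k hk => (hKne ⟨k, hk⟩).elim) (singleton_nonempty 0)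
    exact balanced_zero
  set M := |r + 1 + c| with hM
  -- Chosen so that `δ * d = M + 1 > M`, as the polar bound requires.
  set d := (M + 1) / δ with hd
  have hd0 : 0 < d := by positivity
  refine ⟨d • K, ?_, fun x hx hxc => ?_⟩
  · let := weakTopology B
    have := weakTopology_continuousSMul B
    exact IsCompact.smul d hK.2
  refine mem_smul_of_polar_bound hK hB hKne hδ hd0 (M := M)
    (by rw [hd, mul_div_cancel₀ _ hδ.ne']; linarith) fun y hy => ?_
  have h1 := hKV (y₀ + y) (by simpa using hy)
  have h2 := (hΦ.conj_le_coe_iff (B := B)).1 (le_of_lt h1) x hx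
  rw [map_add] at h2
  linarith [le_abs_self (r + 1 + c)]

end Compactness

/-! ### Existence of minimizers and Fermat's rule -/

section Minimization

variable {X : Type u} {Y : Type v} [AddCommGroup X] [Module ℝ X] [AddCommGroup Y] [Module ℝ Y]
  {B : X →ₗ[ℝ] Y →ₗ[ℝ] ℝ} {Φ : X → EReal}
  [TopologicalSpace X] [IsTopologicalAddGroup X] [ContinuousSMul ℝ X]

/-- Convexity of `q` makes the closed sublevel sets weakly closed. Those at the levels `I + 1 / (n +
1)`, `I` the infimum, are nonempty and nested, and the first is weakly compact, so they have a
common point. -/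
theorem IsGammaZero.exists_isMinOn [LocallyConvexSpace ℝ X] (hcomp : IsCompatible B) (hΦ : IsGammaZero Φ) (y : Y)
    {q : X → ℝ} (hq : Continuous q) (hqc : ConvexOn ℝ univ q) (m : ℝ)
    (hm : ∀ x ∈ dom Φ, m ≤ (Φ x).toReal - B x y + q x)
    (hcpt : ∀ c : ℝ, ∃ K : Set X, @IsCompact X (weakTopology B) K ∧
        ∀ x ∈ dom Φ, (Φ x).toReal - B x y + q x ≤ c → x ∈ K) :
    ∃ x ∈ dom Φ, ∀ u ∈ dom Φ,
      (Φ x).toReal - B x y + q x ≤ (Φ u).toReal - B u y + q u := by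
  set G : X → ℝ := fun x => (Φ x).toReal - B x y + q x with hG
  have hGc : ConvexOn ℝ (dom Φ) G := by
    have h1 := hΦ.convexOn_toReal
    have h2 : ConcaveOn ℝ (dom Φ) fun x => B x y := (B.flip y).concaveOn h1.1
    exact (h1.sub h2).add (hqc.subset (subset_univ _) h1.1)
  let D : ℝ → Set X := fun c => {x ∈ dom Φ | G x ≤ c}
  have hDcl : ∀ c, IsClosed[weakTopology B] (D c) := by
    intro c
    refine isClosed_weakTopology_of_convex hcomp (hGc.convex_le c) ?_
    have : D c = (fun x => (x, c + B x y - q x)) ⁻¹' epi Φ := by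
      ext x
      rw [mem_preimage, hΦ.mem_epi_iff]
      refine and_congr_right fun _ => ?_
      simp only [hG]
      constructor <;> intro h <;> linarith
    rw [this]
    refine hΦ.isClosed_epi.preimage ?_
    have := hcomp.continuous_pairing y
    fun_prop
  obtain ⟨u₀, hu₀⟩ := hΦ.dom_nonempty
  have hbdd : BddBelow (G '' dom Φ) := ⟨m, by rintro _ ⟨x, hx, rfl⟩; exact hm x hx⟩
  have hne : (G '' dom Φ).Nonempty := ⟨_, u₀, hu₀, rfl⟩
  set I := sInf (G '' dom Φ) with hI
  have hDmono : ∀ {a b : ℝ}, a ≤ b → D a ⊆ D b := fun hab x hx => ⟨hx.1, hx.2.trans hab⟩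
  have hint : (⋂ n : ℕ, D (I + 1 / ((n : ℝ) + 1))).Nonempty := by
    obtain ⟨K, hK, hKD⟩ := hcpt (I + 1 / (((0 : ℕ) : ℝ) + 1))
    let := weakTopology B
    refine IsCompact.nonempty_iInter_of_sequence_nonempty_isCompact_isClosed _ (fun n => ?_)
      (fun n => ?_) (hK.of_isClosed_subset (hDcl _) fun x hx => hKD x hx.1 hx.2)
      (fun n => hDcl _)
    · refine hDmono (add_le_add le_rfl ?_)
      push_cast
      exact one_div_le_one_div_of_le (by positivity) (by linarith)
    · obtain ⟨_, ⟨x, hx, rfl⟩, hxI⟩ := exists_lt_of_csInf_lt hne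
        (lt_add_of_pos_right I (show (0 : ℝ) < 1 / ((n : ℝ) + 1) by positivity))
      exact ⟨x, hx, hxI.le⟩
  obtain ⟨x, hx⟩ := hint
  rw [mem_iInter] at hx
  refine ⟨x, (hx 0).1, fun u hu => ?_⟩
  have h1 : G x ≤ I := by
    refine le_of_forall_pos_le_add fun ε hε => ?_
    obtain ⟨n, hn⟩ := exists_nat_one_div_lt hε
    exact (hx n).2.trans (by linarith)
  exact h1.trans (csInf_le hbdd ⟨u, hu, rfl⟩)

/-- Fermat's rule together with the sum rule for `Φ - y + q(· - x₀)`, `q` a continuous seminorm. -/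
theorem IsGammaZero.exists_mem_subdiff_of_isMin (hcomp : IsCompatible B) (hΦ : IsGammaZero Φ)
    (y : Y) (x₀ : X) {q : Seminorm ℝ X} (hq : Continuous q) {x : X} (hx : x ∈ dom Φ)
    (hmin : ∀ u ∈ dom Φ,
      (Φ x).toReal - B x y + q (x - x₀) ≤ (Φ u).toReal - B u y + q (u - x₀)) :
    ∃ z : Y, (∀ a, |B a z| ≤ q a) ∧ y - z ∈ subdiff B Φ x := by
  -- Minimality says that the strict hypograph `S` of the seminorm term misses the epigraph `T` of
  -- `Φ - y`, both normalized to vanish at `x`. Continuity of `q` makes `S` open, so they can be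
  -- separated without any interior condition on `T`.
  set S : Set (X × ℝ) := {p | p.2 < q (x - x₀) - q (p.1 - x₀)} with hS
  set T : Set (X × ℝ) :=
    {p | p.1 ∈ dom Φ ∧ ((Φ p.1).toReal - B p.1 y) - ((Φ x).toReal - B x y) ≤ p.2} with hT
  have hqc : ConvexOn ℝ univ fun u : X => q (u - x₀) := by
    have := q.convexOn.translate_left (-x₀)
    simpa [Function.comp_def, sub_eq_add_neg, add_comm] using this
  have hSo : IsOpen S := isOpen_lt (by fun_prop) (by fun_prop)
  have hSc : Convex ℝ S := by
    have : ConcaveOn ℝ univ fun u : X => q (x - x₀) - q (u - x₀) :=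
      (concaveOn_const _ convex_univ).sub hqc
    simpa [hS] using! this.convex_strict_hypograph
  have hTc : Convex ℝ T := by
    have h1 := hΦ.convexOn_toReal
    have h2 : ConcaveOn ℝ (dom Φ) fun u => B u y + ((Φ x).toReal - B x y) :=
      ((B.flip y).concaveOn h1.1).add (concaveOn_const _ h1.1)
    have h3 := (h1.sub h2).convex_epigraph
    convert h3 using 1
    ext p
    refine and_congr_right fun _ => ?_
    simp only [Pi.sub_apply]
    constructor <;> intro h <;> linarith
  have hdisj : Disjoint S T := by
    rw [Set.disjoint_left]
    rintro ⟨u, t⟩ h1 ⟨h2, h3⟩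
    have := hmin u h2
    simp only [hS, mem_ofPred_eq] at h1 h3
    linarith
  obtain ⟨f, α, hfS, hfT⟩ := geometric_hahn_banach_open hSc hSo hTc hdisj
  obtain ⟨w, hw⟩ := (hcomp (f.comp (ContinuousLinearMap.inl ℝ X ℝ)).toLinearMap).1
    (f.comp (ContinuousLinearMap.inl ℝ X ℝ)).continuous
  set s := f (0, 1) with hs
  have hfe : ∀ (u : X) (t : ℝ), f (u, t) = B u w + t * s := by
    intro u t
    have h1 : (u, t) = ContinuousLinearMap.inl ℝ X ℝ u + t • ((0, 1) : X × ℝ) := by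
      ext <;> simp
    rw [h1, map_add, map_smul, ← hs, ← hw u]
    rfl
  have hS' : ∀ u t, t < q (x - x₀) - q (u - x₀) → B u w + t * s < α := by
    intro u t h
    rw [← hfe]; exact hfS _ h
  have hT' : ∀ u ∈ dom Φ,
      α ≤ B u w + (((Φ u).toReal - B u y) - ((Φ x).toReal - B x y)) * s := by
    intro u hu
    rw [← hfe]; exact hfT _ ⟨hu, le_rfl⟩
  have hα : α ≤ B x w := by simpa using hT' x hx
  -- The hyperplane is not vertical: `(x, -1)` lies in `S` and `(x, 0)` in `T`.
  have hspos : 0 < s := by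
    have := hS' x (-1) (by simp)
    linarith
  have hS'' : ∀ u, B u w + (q (x - x₀) - q (u - x₀)) * s ≤ α := by
    intro u
    refine le_of_forall_pos_le_add fun ε hε => ?_
    have := hS' u (q (x - x₀) - q (u - x₀) - ε / s) (by have := div_pos hε hspos; linarith)
    rw [sub_mul, div_mul_cancel₀ _ hspos.ne'] at this
    linarith
  have hα' : α = B x w := le_antisymm hα (by simpa using hS'' x)
  have hbound : ∀ a, B a w ≤ q a * s := by
    intro a
    have h1 := hS'' (x + a)
    have h2 : q (x + a - x₀) ≤ q (x - x₀) + q a := by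
      rw [show x + a - x₀ = (x - x₀) + a by abel]
      exact map_add_le_add q _ _
    rw [hα', map_add, LinearMap.add_apply] at h1
    nlinarith
  refine ⟨s⁻¹ • w, fun a => ?_, hΦ.mem_subdiff_iff.2 ⟨hx, fun u hu => ?_⟩⟩
  · rw [map_smul, smul_eq_mul, abs_mul, abs_of_pos (inv_pos.2 hspos), inv_mul_le_iff₀ hspos,
      mul_comm s]
    refine abs_le.2 ⟨?_, hbound a⟩
    have := hbound (-a)
    rw [map_neg, LinearMap.neg_apply, map_neg_eq_map] at this
    linarith
  · have h1 := hT' u hu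
    rw [hα'] at h1
    have h2 : s⁻¹ * (B x w - B u w) ≤ ((Φ u).toReal - B u y) - ((Φ x).toReal - B x y) := by
      rw [inv_mul_le_iff₀ hspos]; linarith
    simp only [map_sub, map_smul, smul_eq_mul, LinearMap.sub_apply]
    linarith

end Minimization

/-! ### Approximate multipliers and their replacement by exact subgradients -/

section Approximation

variable {X : Type u} {Y : Type v} [AddCommGroup X] [Module ℝ X] [AddCommGroup Y] [Module ℝ Y]
  {B : X →ₗ[ℝ] Y →ₗ[ℝ] ℝ} {Φ : X → EReal}

/-- The pairs `(η, r)` such that `η` is an `r`-subgradient at `x₀` of some multiple `l Φ`. -/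
def approxMultipliers (B : X →ₗ[ℝ] Y →ₗ[ℝ] ℝ) (Φ : X → EReal) (x₀ : X) : Set (Y × ℝ) :=
  {p | ∃ l : ℝ, 0 < l ∧ ∀ u ∈ dom Φ,
    B (u - x₀) p.1 - l * ((Φ u).toReal - (Φ x₀).toReal) ≤ p.2}

theorem convex_approxMultipliers (x₀ : X) : Convex ℝ (approxMultipliers B Φ x₀) := by
  rintro ⟨η, r⟩ ⟨l, hl, h⟩ ⟨η', r'⟩ ⟨l', hl', h'⟩ a b ha hb hab
  refine ⟨a * l + b * l', ?_, fun u hu => ?_⟩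
  · rcases ha.eq_or_lt with rfl | ha'
    · have : b = 1 := by linarith
      subst this; simpa using hl'
    · have := mul_pos ha' hl
      have := mul_nonneg hb hl'.le
      linarith
  · have h1 := mul_le_mul_of_nonneg_left (h u hu) ha
    have h2 := mul_le_mul_of_nonneg_left (h' u hu) hb
    simp only [Prod.fst_add, Prod.snd_add, Prod.smul_fst, Prod.smul_snd, map_add, map_smul,
      smul_eq_mul] at h1 h2 ⊢
    linarith

/-- Multiples of affine minorants are the test elements: inserted in a separation inequality, they
turn it into a bound on `Φ`, the supremum of its minorants. -/
theorem smul_mem_approxMultipliers {x₀ : X} {y : Y} {c : ℝ}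
    (h : ∀ u ∈ dom Φ, B u y - c ≤ (Φ u).toReal) {l r : ℝ} (hl : 0 < l)
    (hr : l * ((Φ x₀).toReal + c - B x₀ y) ≤ r) :
    (l • y, r) ∈ approxMultipliers B Φ x₀ := by
  refine ⟨l, hl, fun u hu => le_trans ?_ hr⟩
  have := mul_le_mul_of_nonneg_left (h u hu) hl.le
  simp only [map_sub, map_smul, smul_eq_mul, LinearMap.sub_apply]
  linarith

variable [TopologicalSpace X] [IsTopologicalAddGroup X] [ContinuousSMul ℝ X]
  [LocallyConvexSpace ℝ X]

/-- A normal vector to a sublevel set is a weak* limit of approximate subgradients of multiples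
of the function. -/
theorem IsGammaZero.mem_closure_approxMultipliers (hcomp : IsCompatible B) (hΦ : IsGammaZero Φ)
    {x₀ : X} (hx₀ : x₀ ∈ dom Φ) {y₀ : Y} {c₀ : ℝ}
    (h₀ : ∀ u ∈ dom Φ, B u y₀ - c₀ ≤ (Φ u).toReal) {ξ : Y}
    (hξ : ξ ∈ normalCone B (sublevel Φ (Φ x₀)) x₀) :
    (ξ, (0 : ℝ)) ∈ @closure (Y × ℝ)
      (@instTopologicalSpaceProd Y ℝ (weakTopology B.flip) inferInstance)
      (approxMultipliers B Φ x₀) := by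
  let := weakTopology B.flip
  have := weakTopology_isTopologicalAddGroup B.flip
  have := weakTopology_continuousSMul B.flip
  have := weakTopology_locallyConvexSpace B.flip
  by_contra hnot
  obtain ⟨f, α, hf, hfC⟩ := geometric_hahn_banach_point_closed
    (convex_approxMultipliers (B := B) (Φ := Φ) x₀).closure isClosed_closure hnot
  obtain ⟨a, ha⟩ := weakTopology_exists_eq B.flip
    (f.comp (ContinuousLinearMap.inl ℝ Y ℝ)).toLinearMap
    (f.comp (ContinuousLinearMap.inl ℝ Y ℝ)).continuous
  set s := f (0, 1) with hs
  have hfe : ∀ (η : Y) (t : ℝ), f (η, t) = B a η + t * s := by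
    intro η t
    have h1 : (η, t) = ContinuousLinearMap.inl ℝ Y ℝ η + t • ((0, 1) : Y × ℝ) := by
      ext <;> simp
    rw [h1, map_add, map_smul, ← hs]
    exact congrArg (· + t • s) (ha η)
  have hC : ∀ y c, (∀ u ∈ dom Φ, B u y - c ≤ (Φ u).toReal) → ∀ l r : ℝ, 0 < l →
      l * ((Φ x₀).toReal + c - B x₀ y) ≤ r → α < l * B a y + r * s := by
    intro y c h l r hl hr
    have := hfC _ (subset_closure (smul_mem_approxMultipliers h hl hr))
    rwa [hfe, map_smul, smul_eq_mul] at this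
  rw [hfe, zero_mul, add_zero] at hf
  have hs0 : 0 ≤ s := by
    by_contra hneg
    push Not at hneg
    set d := 1 * ((Φ x₀).toReal + c₀ - B x₀ y₀)
    have h1 := hC y₀ c₀ h₀ 1 (max d ((B a y₀ - α) / (-s))) one_pos (le_max_left _ _)
    have h2 : (B a y₀ - α) / (-s) ≤ max d ((B a y₀ - α) / (-s)) := le_max_right _ _
    rw [div_le_iff₀ (by linarith)] at h2
    linarith
  -- It suffices to find a direction of descent which contradicts normality.
  suffices h : α ≤ 0 ∧ ∃ t : ℝ, 0 < t ∧ x₀ - t • a ∈ sublevel Φ (Φ x₀) by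
    obtain ⟨hα, t, ht, hmem⟩ := h
    have := hξ _ hmem
    rw [sub_sub_cancel_left, map_neg, map_smul, LinearMap.neg_apply, LinearMap.smul_apply,
      smul_eq_mul] at this
    have : 0 ≤ t * B a ξ := by linarith
    have := nonneg_of_mul_nonneg_right this ht
    linarith
  -- If `s = 0`, then `α < l * B a y` for every slope `y` of an affine minorant and every `l > 0`.
  -- Small `l` gives `α ≤ 0`; large `l` excludes `B a y < 0`, so no minorant exceeds `Φ x₀` at `x₀ -
  -- a`.
  rcases hs0.eq_or_lt with h0 | hpos
  · rw [← h0] at hC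
    simp only [mul_zero, add_zero] at hC
    refine ⟨?_, 1, one_pos, ?_⟩
    · by_contra hα
      push Not at hα
      have h1 := hC y₀ c₀ h₀ (α / (|B a y₀| + 1)) _ (by positivity) le_rfl
      rw [div_mul_eq_mul_div, lt_div_iff₀ (by positivity)] at h1
      nlinarith [le_abs_self (B a y₀)]
    · rw [one_smul, hΦ.mem_sublevel_iff hx₀, ← hΦ.mem_epi_iff]
      by_contra hne
      obtain ⟨y, c, hy, hlt⟩ := hΦ.exists_affine_minorant hcomp h₀ hne
      have h1 := hy x₀ hx₀
      rw [map_sub, LinearMap.sub_apply] at hlt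
      have hneg : B a y < 0 := by linarith
      have h2 := hC y c hy ((|α| + 1) / (-B a y))  _
        (div_pos (by positivity) (by linarith)) le_rfl
      have h3 : (|α| + 1) / (-B a y) * B a y = -(|α| + 1) := by
        field_simp [hneg.ne]
      rw [h3] at h2
      linarith [neg_abs_le α]
  · have hepi : ∀ l : ℝ, 0 < l → (x₀ - s⁻¹ • a, (Φ x₀).toReal - α / s / l) ∈ epi Φ := by
      intro l hl
      by_contra hne
      obtain ⟨y, c, hy, hlt⟩ := hΦ.exists_affine_minorant hcomp h₀ hne
      have h1 := hC y c hy l _ hl le_rfl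
      simp only [map_sub, map_smul, smul_eq_mul, LinearMap.sub_apply, LinearMap.smul_apply] at hlt
      have h2 : α < s * l * (s⁻¹ * B a y + ((Φ x₀).toReal + c - B x₀ y)) := by
        calc α < _ := h1
          _ = _ := by field_simp
      have h3 : s * l * (α / s / l) = α := by field_simp
      have h4 : s * l * (s⁻¹ * B a y + ((Φ x₀).toReal + c - B x₀ y)) < s * l * (α / s / l) :=
        mul_lt_mul_of_pos_left (by linarith) (by positivity)
      linarith
    have hdom : x₀ - s⁻¹ • a ∈ dom Φ := (hΦ.mem_epi_iff.1 (hepi 1 one_pos)).1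
    set d := (Φ (x₀ - s⁻¹ • a)).toReal - (Φ x₀).toReal with hd
    have hle : ∀ l : ℝ, 0 < l → l * d ≤ - (α / s) := by
      intro l hl
      have h1 := (hΦ.mem_epi_iff.1 (hepi l hl)).2
      have h2 : l * d ≤ l * (-(α / s / l)) := mul_le_mul_of_nonneg_left (by linarith) hl.le
      calc l * d ≤ _ := h2
        _ = _ := by field_simp
    refine ⟨?_, s⁻¹, inv_pos.2 hpos, ?_⟩
    · by_contra hα
      push Not at hα
      have hp : 0 < α / s := div_pos hα hpos
      have h1 := hle (α / s / (|d| + 1)) (by positivity)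
      have h2 : α / s / (|d| + 1) * (|d| + 1) = α / s := by field_simp
      nlinarith [neg_abs_le d, div_pos hp (show 0 < |d| + 1 by positivity)]
    · rw [hΦ.mem_sublevel_iff hx₀]
      refine ⟨hdom, ?_⟩
      by_contra hgt
      have hd0 : 0 < d := by push Not at hgt; linarith
      have h1 := hle ((|α / s| + 1) / d) (by positivity)
      rw [div_mul_cancel₀ _ hd0.ne'] at h1
      linarith [neg_abs_le (α / s)]

theorem IsGammaZero.exists_approx_multiplier (hcomp : IsCompatible B) (hΦ : IsGammaZero Φ)
    {x₀ : X} (hx₀ : x₀ ∈ dom Φ) {y₀ : Y} {c₀ : ℝ}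
    (h₀ : ∀ u ∈ dom Φ, B u y₀ - c₀ ≤ (Φ u).toReal) {ξ : Y}
    (hξ : ξ ∈ normalCone B (sublevel Φ (Φ x₀)) x₀) (A : Finset X) {δ ε : ℝ} (hδ : 0 < δ)
    (hε : 0 < ε) :
    ∃ (η : Y) (l : ℝ), (∀ a ∈ A, |B a η - B a ξ| < δ) ∧ 0 < l ∧
      ∀ u ∈ dom Φ, B (u - x₀) η ≤ l * ((Φ u).toReal - (Φ x₀).toReal) + ε := by
  have hmem := hΦ.mem_closure_approxMultipliers hcomp hx₀ h₀ hξ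
  let := weakTopology B.flip
  have hV : {η : Y | ∀ a ∈ A, |B a η - B a ξ| < δ} ∈ 𝓝 ξ := by
    have : {η : Y | ∀ a ∈ A, |B a η - B a ξ| < δ} = ⋂ a ∈ A, {η | |B a η - B a ξ| < δ} := by
      ext; simp
    rw [this, Filter.biInter_finset_mem]
    intro a _
    have hc : Continuous fun η : Y => B a η := continuous_weakTopology B.flip a
    exact (isOpen_lt (by fun_prop) continuous_const).mem_nhds (by simpa using hδ)
  obtain ⟨⟨η, r⟩, ⟨hη, hr⟩, l, hl, h⟩ :=
    mem_closure_iff_nhds.1 hmem _ (prod_mem_nhds hV (Iio_mem_nhds hε))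
  refine ⟨η, l, hη, hl, fun u hu => ?_⟩
  have h1 := h u hu
  have h2 : r < ε := hr
  simp only at h1
  linarith

/-- A Brøndsted–Rockafellar type principle for epi-pointed functions. -/
theorem IsGammaZero.exists_subgradient_near (hcomp : IsCompatible B) (hΦ : IsGammaZero Φ)
    {x₀ : X} (hx₀ : x₀ ∈ dom Φ) {y₀ : Y} {M : ℝ}
    (h₀ : ∀ u ∈ dom Φ, B (u - x₀) y₀ ≤ (Φ u).toReal - (Φ x₀).toReal + M)
    (hcpt : ∀ c : ℝ, ∃ K : Set X, @IsCompact X (weakTopology B) K ∧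
        ∀ x ∈ dom Φ, (Φ x).toReal - B x y₀ ≤ c → x ∈ K)
    {η : Y} {l ε t k : ℝ} (hl : 0 < l) (ht : 0 < t) (hk : 0 ≤ k)
    (h : ∀ u ∈ dom Φ, B (u - x₀) η ≤ l * ((Φ u).toReal - (Φ x₀).toReal) + ε)
    {p : Seminorm ℝ X} (hp : Continuous p) :
    ∃ (x : X) (μ : ℝ) (y : Y), 0 ≤ μ ∧ y ∈ subdiff B Φ x ∧ k * p (x - x₀) ≤ ε + t * M ∧
      (∀ a, |B a (μ • y) - (B a η + t * B a y₀)| ≤ k * p a) ∧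
      |μ * ((Φ x).toReal - (Φ x₀).toReal) - (B (x - x₀) η + t * B (x - x₀) y₀)| ≤
        ε + t * M := by
  -- With these choices `μ (Φ - y') = (l Φ - η) + t (Φ - y₀)`. The first summand is bounded below,
  -- so the sum inherits the weakly compact sublevel sets of the second.
  set μ := l + t with hμ
  have hμ0 : 0 < μ := by positivity
  set y' := μ⁻¹ • (η + t • y₀) with hy'
  have hy'' : ∀ a, μ * B a y' = B a η + t * B a y₀ := by
    intro a
    simp only [hy', map_smul, map_add, smul_eq_mul]
    field_simp
  set q : Seminorm ℝ X := (k / μ).toNNReal • p with hq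
  have hqe : ∀ a, q a = k / μ * p a := fun a => by
    rw [hq, _root_.smul_apply, NNReal.smul_def, Real.coe_toNNReal _ (by positivity), smul_eq_mul]
  have hqc : Continuous q := by
    rw [show (q : X → ℝ) = fun a => k / μ * p a from funext hqe]
    fun_prop
  have hqμ : ∀ a, μ * q a = k * p a := fun a => by
    rw [hqe]; field_simp
  have hlow : ∀ u ∈ dom Φ,
      -(ε + t * M) ≤ μ * ((Φ u).toReal - (Φ x₀).toReal) - μ * B (u - x₀) y' := by
    intro u hu
    rw [hy'']
    have h1 := h u hu
    have h2 := mul_le_mul_of_nonneg_left (h₀ u hu) ht.le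
    rw [hμ]
    linarith
  have hqconv : ConvexOn ℝ univ fun u : X => q (u - x₀) := by
    have := q.convexOn.translate_left (-x₀)
    simpa [Function.comp_def, sub_eq_add_neg, add_comm] using this
  obtain ⟨x, hx, hmin⟩ := hΦ.exists_isMinOn hcomp y' (q := fun u => q (u - x₀)) (by fun_prop)
    hqconv ((Φ x₀).toReal - B x₀ y' - (ε + t * M) / μ)
    (fun u hu => by
      have h1 := hlow u hu
      have h2 : μ * ((ε + t * M) / μ) = ε + t * M := by field_simp
      have h3 : 0 ≤ q (u - x₀) := apply_nonneg q _
      rw [map_sub, LinearMap.sub_apply] at h1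
      have h4 : 0 ≤ μ * ((Φ u).toReal - B u y' - ((Φ x₀).toReal - B x₀ y' - (ε + t * M) / μ)) := by
        linarith
      have := nonneg_of_mul_nonneg_right h4 hμ0
      linarith)
    (fun c => by
      obtain ⟨K, hK, hKc⟩ := hcpt
        ((μ * (c - ((Φ x₀).toReal - B x₀ y')) + ε) / t + (Φ x₀).toReal - B x₀ y₀)
      refine ⟨K, hK, fun u hu huc => hKc u hu ?_⟩
      have h1 := h u hu
      have h2 : (Φ u).toReal - B u y' ≤ c := by
        have h3 : 0 ≤ q (u - x₀) := apply_nonneg q _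
        linarith
      have h3 := mul_le_mul_of_nonneg_left h2 hμ0.le
      have h4 : (Φ u).toReal - B u y₀ - ((Φ x₀).toReal - B x₀ y₀) ≤
          (μ * (c - ((Φ x₀).toReal - B x₀ y')) + ε) / t := by
        rw [le_div_iff₀ ht]
        rw [map_sub, LinearMap.sub_apply] at h1
        rw [mul_sub, hy''] at h3
        rw [mul_sub μ c, mul_sub μ, hy'']
        rw [hμ] at h3 ⊢
        linarith
      linarith)
  obtain ⟨z, hz, hsub⟩ := hΦ.exists_mem_subdiff_of_isMin hcomp y' x₀ hqc hx hmin
  have hmin₀ := mul_le_mul_of_nonneg_left (hmin x₀ hx₀) hμ0.le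
  rw [sub_self, map_zero, add_zero, mul_add, hqμ] at hmin₀
  have hlowx := hlow x hx
  have hpx : 0 ≤ k * p (x - x₀) := mul_nonneg hk (apply_nonneg p _)
  have hB : B (x - x₀) y' = B x y' - B x₀ y' := by rw [map_sub, LinearMap.sub_apply]
  refine ⟨x, μ, y' - z, hμ0.le, hsub, ?_, fun a => ?_, ?_⟩
  · rw [hB] at hlowx
    linarith
  · rw [map_smul, map_sub, smul_eq_mul, mul_sub, hy'', sub_sub_cancel_left, abs_neg, abs_mul,
      abs_of_pos hμ0, ← hqμ]
    exact mul_le_mul_of_nonneg_left (hz a) hμ0.le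
  · rw [← hy'', abs_le]
    refine ⟨hlowx, ?_⟩
    -- At `x₀` the lower bound reads `0 ≤ ε + t * M`, while comparing the minimizer with `x₀` shows
    -- that the quantity to be bounded above is at most `0`.
    have h1 := hlow x₀ hx₀
    simp only [sub_self, mul_zero, map_zero, LinearMap.zero_apply] at h1
    rw [hB]
    linarith

end Approximation

/-! ### The two inclusions for the upper limits -/

theorem upperLimit_mono {U V : Type*} (t : TopologicalSpace V) {l l' : Filter U} (h : l ≤ l')
    (M : U → Set V) : upperLimit t l M ⊆ upperLimit t l' M :=
  fun _ hv W hW Z hZ => hv W hW Z (h hZ)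

section UpperLimit

variable {X : Type u} {Y : Type v} [AddCommGroup X] [Module ℝ X] [AddCommGroup Y] [Module ℝ Y]
  {B : X →ₗ[ℝ] Y →ₗ[ℝ] ℝ} {Φ : X → EReal}

theorem mem_paramFilter_iff {x₀ : X} {Z : Set (X × ℝ × Y)} :
    Z ∈ paramFilter B Φ x₀ ↔ ∃ ε > 0, ∀ x μ y, x ∈ dom Φ → 0 ≤ μ →
      |μ * ((Φ x).toReal - (Φ x₀).toReal)| < ε → |μ * B (x - x₀) y| < ε → (x, μ, y) ∈ Z := by
  have hb : (𝓝 (0 : ℝ)).HasBasis (fun ε : ℝ => 0 < ε) (Metric.ball 0) := Metric.nhds_basis_ball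
  constructor
  · intro h
    obtain ⟨S, hS, T, hT, rfl⟩ := Filter.mem_inf_iff.1 h
    obtain ⟨P, hP, Q, hQ, rfl⟩ := Filter.mem_inf_iff.1 hS
    obtain ⟨a, ha, haQ⟩ := (hb.comap _).mem_iff.1 hQ
    obtain ⟨b, hb', hbT⟩ := (hb.comap _).mem_iff.1 hT
    refine ⟨min a b, lt_min ha hb', fun x μ y hx hμ h1 h2 => ⟨⟨hP ⟨hx, hμ⟩, haQ ?_⟩, hbT ?_⟩⟩
    · simpa using h1.trans_le (min_le_left a b)
    · simpa only [mem_preimage, mem_ball_zero_iff, Real.norm_eq_abs] using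
        h2.trans_le (min_le_right a b)
  · rintro ⟨ε, hε, h⟩
    refine mem_of_superset (inter_mem_inf (inter_mem_inf (mem_principal_self _)
      (preimage_mem_comap (Metric.ball_mem_nhds 0 hε)))
      (preimage_mem_comap (Metric.ball_mem_nhds 0 hε))) ?_
    rintro ⟨x, μ, y⟩ ⟨⟨⟨hx, hμ⟩, h1⟩, h2⟩
    exact h x μ y hx hμ (by simpa using h1)
      (by simpa only [mem_preimage, mem_ball_zero_iff, Real.norm_eq_abs] using h2)

variable [TopologicalSpace X]

theorem exists_seminorm_of_mem_nhds [IsTopologicalAddGroup X] [ContinuousSMul ℝ X]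
    [LocallyConvexSpace ℝ X] {x₀ : X} {U : Set X} (hU : U ∈ 𝓝 x₀) :
    ∃ p : Seminorm ℝ X, Continuous p ∧ ∀ x, p (x - x₀) < 1 → x ∈ U := by
  have hU0 : (fun a => x₀ + a) ⁻¹' U ∈ 𝓝 (0 : X) :=
    (by fun_prop : Continuous fun a => x₀ + a).continuousAt (by simpa using hU)
  obtain ⟨s, hs, hsU⟩ := (nhds_hasBasis_absConvex_open ℝ X).mem_iff.1 hU0
  let S : AbsConvexOpenSets ℝ X := ⟨s, hs⟩
  refine ⟨gaugeSeminormFamily ℝ X S, with_gaugeSeminormFamily.continuous_seminorm S,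
    fun x hx => ?_⟩
  have h1 : x - x₀ ∈ (gaugeSeminormFamily ℝ X S).ball 0 1 := by
    rwa [Seminorm.mem_ball_zero]
  rw [gaugeSeminormFamily_ball] at h1
  have h2 : x₀ + (x - x₀) ∈ U := hsU h1
  rwa [add_sub_cancel] at h2

theorem IsGammaZero.exists_scaled_subgradient_near [IsTopologicalAddGroup X] [ContinuousSMul ℝ X]
    [LocallyConvexSpace ℝ X] (hB : B.SeparatingLeft) (hcomp : IsCompatible B)
    (hΦ : IsGammaZero Φ) (hepi : EpiPointed B Φ) {x₀ : X} (hx₀ : x₀ ∈ dom Φ) {ξ : Y}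
    (hξ : ξ ∈ normalCone B (sublevel Φ (Φ x₀)) x₀) {W : Set Y}
    (hW : W ∈ @nhds Y (weakTopology B.flip) ξ) {U : Set X} (hU : U ∈ 𝓝 x₀) {ε : ℝ} (hε : 0 < ε) :
    ∃ (x : X) (μ : ℝ) (y : Y), x ∈ U ∧ 0 ≤ μ ∧ y ∈ subdiff B Φ x ∧
      |μ * ((Φ x).toReal - (Φ x₀).toReal)| < ε ∧ |μ * B (x - x₀) y| < ε ∧ μ • y ∈ W := by
  obtain ⟨y₀, c₀, h₀, hcpt⟩ := hΦ.exists_compact_of_epiPointed hB hepi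
  obtain ⟨A, δ, hδ, hA⟩ := exists_finset_subset_of_mem_nhds_weakTopology hW
  obtain ⟨p₀, hp₀, hp₀U⟩ := exists_seminorm_of_mem_nhds hU
  set M := (Φ x₀).toReal + c₀ - B x₀ y₀ with hM
  have hM0 : 0 ≤ M := by have := h₀ x₀ hx₀; linarith
  -- `C` is to bound `p` on `A`. It must be fixed before `s`, whereas `η` is chosen after `s`; hence
  -- `|B a ξ| + 1` stands in for `|B a η|`, which explains the `min 1` in the tolerance for `η`.
  set C := ∑ a ∈ A, (p₀ a + |B a y₀| + |B a ξ| + 1) with hC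
  have hCa : ∀ a ∈ A, p₀ a + |B a y₀| + |B a ξ| + 1 ≤ C := fun a ha =>
    Finset.single_le_sum (f := fun a => p₀ a + |B a y₀| + |B a ξ| + 1)
      (fun b _ => by have := apply_nonneg p₀ b; positivity) ha
  have hC0 : 0 ≤ C := Finset.sum_nonneg fun b _ => by have := apply_nonneg p₀ b; positivity
  -- `s` bounds the distance to `x₀` and the size of the perturbation of `ξ`
  obtain ⟨s, hs0, hs1, hsε, hsδ⟩ : ∃ s : ℝ, 0 < s ∧ s < 1 ∧ 4 * s < ε ∧ 4 * (s * C) < δ := by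
    refine ⟨min (1 / 2) (min (ε / 8) (δ / (8 * (C + 1)))), by positivity,
      (min_le_left _ _).trans_lt (by norm_num), ?_, ?_⟩
    · have := (min_le_right (1 / 2) (min (ε / 8) (δ / (8 * (C + 1))))).trans (min_le_left _ _)
      linarith
    · have h1 := (min_le_right (1 / 2) (min (ε / 8) (δ / (8 * (C + 1))))).trans (min_le_right _ _)
      rw [le_div_iff₀ (by positivity)] at h1
      have h2 : 0 < min (1 / 2) (min (ε / 8) (δ / (8 * (C + 1)))) := by positivity
      nlinarith
  obtain ⟨t, ht0, hts, htM⟩ : ∃ t : ℝ, 0 < t ∧ t ≤ s ∧ t * M ≤ s ^ 2 / 2 := by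
    refine ⟨min s (s ^ 2 / (2 * (M + 1))), by positivity, min_le_left _ _, ?_⟩
    have h1 := min_le_right s (s ^ 2 / (2 * (M + 1)))
    rw [le_div_iff₀ (by positivity)] at h1
    have h2 : 0 < min s (s ^ 2 / (2 * (M + 1))) := by positivity
    nlinarith
  obtain ⟨η, l, hη, hl, hηl⟩ := hΦ.exists_approx_multiplier hcomp hx₀ h₀ hξ A
    (δ := min 1 (δ / 2)) (ε := s ^ 2 / 2) (by positivity) (by positivity)
  -- Including `y₀` and `η` in the seminorm makes `p (x - x₀) ≤ s` control their pairings with `x -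
  -- x₀` as well as the neighbourhood `U`. The bound itself follows from `k = s` and a total error
  -- of at most `s ^ 2`.
  set p : Seminorm ℝ X := p₀ + (B.flip y₀).toSeminorm + (B.flip η).toSeminorm with hp
  have hpe : ∀ a, p a = p₀ a + |B a y₀| + |B a η| := fun a => rfl
  have hpc : Continuous p := by
    rw [show (p : X → ℝ) = fun a => p₀ a + |B a y₀| + |B a η| from funext hpe]
    have := hcomp.continuous_pairing y₀
    have := hcomp.continuous_pairing η
    fun_prop
  obtain ⟨x, μ, y, hμ, hy, hpx, hyη, hval⟩ := hΦ.exists_subgradient_near hcomp hx₀ (M := M)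
    (fun u hu => by
      have := h₀ u hu
      rw [map_sub, LinearMap.sub_apply]; linarith) hcpt hl ht0 hs0.le hηl hpc
  have hs2 : s ^ 2 ≤ s := by nlinarith
  have hpxs : p (x - x₀) ≤ s := by
    have h1 : s * p (x - x₀) ≤ s * s := by nlinarith
    exact le_of_mul_le_mul_left h1 hs0
  rw [hpe] at hpxs
  have hn1 := apply_nonneg p₀ (x - x₀)
  have hn2 := abs_nonneg (B (x - x₀) y₀)
  have hn3 := abs_nonneg (B (x - x₀) η)
  have ht1 : |t * B (x - x₀) y₀| ≤ s := by
    rw [abs_mul, abs_of_pos ht0]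
    nlinarith
  have hsum : |B (x - x₀) η + t * B (x - x₀) y₀| ≤ 2 * s := by
    have := abs_add_le (B (x - x₀) η) (t * B (x - x₀) y₀)
    linarith
  refine ⟨x, μ, y, hp₀U x (by linarith), hμ, hy, ?_, ?_, hA _ fun a ha => ?_⟩
  · have h1 := abs_sub_abs_le_abs_sub (μ * ((Φ x).toReal - (Φ x₀).toReal))
      (B (x - x₀) η + t * B (x - x₀) y₀)
    linarith
  · have h1 := hyη (x - x₀)
    have h2 := abs_sub_abs_le_abs_sub (B (x - x₀) (μ • y)) (B (x - x₀) η + t * B (x - x₀) y₀)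
    rw [map_smul, smul_eq_mul] at h1 h2
    linarith
  · have h1 := hyη a
    have h2 := hη a ha
    have h3 := hCa a ha
    have h4 : |B a η| ≤ |B a ξ| + 1 := by
      have := abs_sub_abs_le_abs_sub (B a η) (B a ξ)
      have := h2.trans_le (min_le_left _ _)
      linarith
    have h5 : s * p a ≤ s * C := mul_le_mul_of_nonneg_left (by rw [hpe]; linarith) hs0.le
    have h6 : |t * B a y₀| ≤ s * C := by
      rw [abs_mul, abs_of_pos ht0]
      have := apply_nonneg p₀ a
      have := abs_nonneg (B a ξ)
      exact mul_le_mul hts (by linarith) (abs_nonneg _) hs0.le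
    have h7 := h2.trans_le (min_le_right _ _)
    change |B a (μ • y) - B a ξ| < δ
    calc |B a (μ • y) - B a ξ|
        = |(B a (μ • y) - (B a η + t * B a y₀)) + t * B a y₀ + (B a η - B a ξ)| := by
          congr 1; ring
      _ ≤ |B a (μ • y) - (B a η + t * B a y₀)| + |t * B a y₀| + |B a η - B a ξ| :=
          abs_add_three _ _ _
      _ < δ := by linarith

/-- For `u` in the sublevel set, `μ⟨y, u - x₀⟩ = μ⟨y, u - x⟩ + μ⟨y, x - x₀⟩ ≤ μ(Φ x₀ - Φ x) + μ⟨y, x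
- x₀⟩`, and both terms on the right tend to `0`. -/
theorem IsGammaZero.upperLimit_subset_normalCone (hΦ : IsGammaZero Φ) {x₀ : X}
    (hx₀ : x₀ ∈ dom Φ) :
    upperLimit (weakTopology B.flip) (paramFilter B Φ x₀) (scaledSubdiff B Φ) ⊆
      normalCone B (sublevel Φ (Φ x₀)) x₀ := by
  intro ξ hξ u hu
  obtain ⟨hud, hule⟩ := (hΦ.mem_sublevel_iff hx₀).1 hu
  refine le_of_forall_pos_le_add fun ε hε => ?_
  have hW : {η : Y | B (u - x₀) ξ < B (u - x₀) η + ε / 3} ∈ @nhds Y (weakTopology B.flip) ξ := by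
    let := weakTopology B.flip
    have hc : Continuous fun η : Y => B (u - x₀) η := continuous_weakTopology B.flip (u - x₀)
    refine (isOpen_lt continuous_const (by fun_prop)).mem_nhds ?_
    simp only [mem_ofPred_eq]
    linarith
  have hZ : {q : X × ℝ × Y | 0 ≤ q.2.1 ∧
      |q.2.1 * ((Φ q.1).toReal - (Φ x₀).toReal)| < ε / 3 ∧ |q.2.1 * B (q.1 - x₀) q.2.2| < ε / 3} ∈
      paramFilter B Φ x₀ :=
    mem_paramFilter_iff.2 ⟨ε / 3, by positivity, fun x μ y _ hμ h1 h2 => ⟨hμ, h1, h2⟩⟩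
  obtain ⟨⟨x, μ, y⟩, ⟨hμ, h1, h2⟩, _, ⟨hy, rfl⟩, hw⟩ := hξ _ hW _ hZ
  simp only [mem_ofPred_eq, map_smul, smul_eq_mul] at hμ h1 h2 hw hy
  have h3 := mul_le_mul_of_nonneg_left ((hΦ.mem_subdiff_iff.1 hy).2 u hud) hμ
  have h4 := mul_le_mul_of_nonneg_left hule hμ
  have h5 := (abs_lt.1 h1).1
  have h6 := (abs_lt.1 h2).2
  simp only [map_sub, LinearMap.sub_apply] at h3 h6 hw ⊢
  linarith

theorem IsGammaZero.normalCone_subset_upperLimit [IsTopologicalAddGroup X] [ContinuousSMul ℝ X]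
    [LocallyConvexSpace ℝ X] (hB : B.SeparatingLeft) (hcomp : IsCompatible B)
    (hΦ : IsGammaZero Φ) (hepi : EpiPointed B Φ) {x₀ : X} (hx₀ : x₀ ∈ dom Φ) :
    normalCone B (sublevel Φ (Φ x₀)) x₀ ⊆
      upperLimit (weakTopology B.flip) (paramFilterAt B Φ x₀) (scaledSubdiff B Φ) := by
  intro ξ hξ W hW Z hZ
  obtain ⟨S, ⟨U, hU, hUS⟩, T, hT, rfl⟩ := Filter.mem_inf_iff.1 hZ
  obtain ⟨ε, hε, hεT⟩ := mem_paramFilter_iff.1 hT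
  obtain ⟨x, μ, y, hxU, hμ, hy, h1, h2, hyW⟩ :=
    hΦ.exists_scaled_subgradient_near hB hcomp hepi hx₀ hξ hW hU hε
  exact ⟨(x, μ, y), ⟨hUS hxU, hεT x μ y hy.1 hμ h1 h2⟩, μ • y, ⟨hy, rfl⟩, hyW⟩

end UpperLimit

/-! ### Upper limits read with nets -/

/-- A nontrivial filter is the limit of a net with values in any prescribed member. -/
theorem exists_net_tendsto {α : Type u} (l : Filter α) [l.NeBot] {T : Set α} (hT : T ∈ l) :
    ∃ (ι : Type u) (_ : Preorder ι) (_ : IsDirectedOrder ι) (_ : Nonempty ι) (f : ι → α),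
      (∀ i, f i ∈ T) ∧ Tendsto f atTop l := by
  -- Pairs of a member of the filter and a point in it, ordered by reverse inclusion of the sets
  -- alone; this is only a preorder.
  let ι := {q : α × Set α // q.2 ∈ l ∧ q.2 ⊆ T ∧ q.1 ∈ q.2}
  let : Preorder ι := Preorder.lift fun q : ι => OrderDual.toDual q.1.2
  have hle : ∀ {q r : ι}, q ≤ r ↔ r.1.2 ⊆ q.1.2 := Iff.rfl
  have hex : ∀ S ∈ l, ∃ q : ι, q.1.2 ⊆ S := fun S hS => by
    obtain ⟨a, ha⟩ := Filter.nonempty_of_mem (inter_mem hS hT)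
    exact ⟨⟨(a, S ∩ T), inter_mem hS hT, inter_subset_right, ha⟩, inter_subset_left⟩
  refine ⟨ι, inferInstance, ⟨fun q r => ?_⟩, (hex univ univ_mem).nonempty, fun q => q.1.1,
    fun q => q.2.2.1 q.2.2.2, fun S hS => ?_⟩
  · obtain ⟨w, hw⟩ := hex _ (inter_mem q.2.1 r.2.1)
    exact ⟨w, hle.2 (hw.trans inter_subset_left), hle.2 (hw.trans inter_subset_right)⟩
  · obtain ⟨w, hw⟩ := hex S hS
    exact Filter.mem_map.2 <| mem_of_superset (mem_atTop w) fun q hq => hw (hle.1 hq q.2.2.2)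

/-- Membership in the upper limit says that the parameter filter meets the pullback of `𝓝 ξ` under
`(x, μ, y) ↦ μ • y` on the graph of the subdifferential. A net for this common refinement has all
the required limits. -/
theorem exists_net_of_mem_upperLimit {X : Type u} {Y : Type v} [AddCommGroup X] [Module ℝ X]
    [AddCommGroup Y] [Module ℝ Y] [TopologicalSpace X] {B : X →ₗ[ℝ] Y →ₗ[ℝ] ℝ} {Φ : X → EReal}
    {x₀ : X} {ξ : Y} (hξ : ξ ∈ upperLimit (weakTopology B.flip) (paramFilterAt B Φ x₀)
      (scaledSubdiff B Φ)) :
    ∃ (ι : Type (max u v)) (_ : Preorder ι) (_ : IsDirectedOrder ι) (_ : Nonempty ι)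
      (x : ι → X) (μ : ι → ℝ) (y : ι → Y),
      (∀ i, 0 ≤ μ i) ∧ (∀ i, y i ∈ subdiff B Φ (x i)) ∧
      Tendsto x atTop (𝓝 x₀) ∧
      Tendsto (fun i => μ i * ((Φ (x i)).toReal - (Φ x₀).toReal)) atTop (𝓝 0) ∧
      Tendsto (fun i => μ i * B (x i - x₀) (y i)) atTop (𝓝 0) ∧
      Tendsto (fun i => μ i • y i) atTop (@nhds Y (weakTopology B.flip) ξ) := by
  let := weakTopology B.flip
  set G : Filter (X × ℝ × Y) := paramFilterAt B Φ x₀ ⊓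
    (comap (fun p : X × ℝ × Y => p.2.1 • p.2.2) (𝓝 ξ) ⊓ 𝓟 {p | p.2.2 ∈ subdiff B Φ p.1}) with hG
  have hne : G.NeBot := by
    rw [hG, Filter.inf_neBot_iff]
    intro Z hZ R hR
    obtain ⟨W, hW, hWR⟩ := Filter.mem_comap.1 (Filter.mem_inf_principal.1 hR)
    obtain ⟨p, hpZ, _, ⟨hp, rfl⟩, hpW⟩ := hξ W hW Z hZ
    exact ⟨p, hpZ, hWR hpW hp⟩
  have h1 : G ≤ paramFilterAt B Φ x₀ := inf_le_left
  have h2 : G ≤ paramFilter B Φ x₀ := h1.trans inf_le_right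
  have hT : {p : X × ℝ × Y | 0 ≤ p.2.1 ∧ p.2.2 ∈ subdiff B Φ p.1} ∈ G := by
    have ha : {p : X × ℝ × Y | p.1 ∈ dom Φ ∧ 0 ≤ p.2.1} ∈ G :=
      (h2.trans (inf_le_left.trans inf_le_left)) (mem_principal_self _)
    have hb : {p : X × ℝ × Y | p.2.2 ∈ subdiff B Φ p.1} ∈ G :=
      (inf_le_right.trans inf_le_right : G ≤ _) (mem_principal_self _)
    exact mem_of_superset (inter_mem ha hb) fun p hp => ⟨hp.1.2, hp.2⟩
  obtain ⟨ι, i₁, i₂, i₃, f, hfT, hf⟩ := exists_net_tendsto G hT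
  refine ⟨ι, i₁, i₂, i₃, fun i => (f i).1, fun i => (f i).2.1, fun i => (f i).2.2,
    fun i => (hfT i).1, fun i => (hfT i).2, ?_, ?_, ?_, ?_⟩
  · exact tendsto_comap_iff.1 (hf.mono_right (h1.trans inf_le_left))
  · exact tendsto_comap_iff.1 (hf.mono_right (h2.trans (inf_le_left.trans inf_le_right)))
  · exact tendsto_comap_iff.1 (hf.mono_right (h2.trans inf_le_right))
  · exact tendsto_comap_iff.1 (hf.mono_right (inf_le_right.trans inf_le_left))

end DualPair

theorem lemma4p3
    {X : Type u} {Y : Type v}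
    [AddCommGroup X] [Module ℝ X] [TopologicalSpace X] [IsTopologicalAddGroup X]
    [ContinuousSMul ℝ X] [LocallyConvexSpace ℝ X]
    [AddCommGroup Y] [Module ℝ Y]
    (B : X →ₗ[ℝ] Y →ₗ[ℝ] ℝ) (hB : B.Nondegenerate) (hcomp : DualPair.IsCompatible B)
    (Φ : X → EReal) (hΦ : DualPair.IsGammaZero Φ) (hepi : DualPair.EpiPointed B Φ)
    (x₀ : X) (hx₀ : x₀ ∈ DualPair.dom Φ) :
    -- the upper limit with `x → x₀`
    DualPair.normalCone B (DualPair.sublevel Φ (Φ x₀)) x₀ =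
      DualPair.upperLimit (DualPair.weakTopology B.flip) (DualPair.paramFilterAt B Φ x₀)
        (DualPair.scaledSubdiff B Φ) ∧
    -- its reading with nets
    (∀ ξ ∈ DualPair.normalCone B (DualPair.sublevel Φ (Φ x₀)) x₀,
      ∃ (ι : Type (max u v)) (_ : Preorder ι) (_ : IsDirectedOrder ι) (_ : Nonempty ι)
        (x : ι → X) (μ : ι → ℝ) (y : ι → Y),
        (∀ i, 0 ≤ μ i) ∧ (∀ i, y i ∈ DualPair.subdiff B Φ (x i)) ∧
        Tendsto x atTop (𝓝 x₀) ∧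
        Tendsto (fun i => μ i * ((Φ (x i)).toReal - (Φ x₀).toReal)) atTop (𝓝 0) ∧
        Tendsto (fun i => μ i * B (x i - x₀) (y i)) atTop (𝓝 0) ∧
        Tendsto (fun i => μ i • y i) atTop (@nhds Y (DualPair.weakTopology B.flip) ξ)) ∧
    -- the upper limit without `x → x₀`
    DualPair.normalCone B (DualPair.sublevel Φ (Φ x₀)) x₀ =
      DualPair.upperLimit (DualPair.weakTopology B.flip) (DualPair.paramFilter B Φ x₀)
        (DualPair.scaledSubdiff B Φ) := by
  have hsub := hΦ.normalCone_subset_upperLimit hB.1 hcomp hepi hx₀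
  have hmono := DualPair.upperLimit_mono (DualPair.weakTopology B.flip)
    (inf_le_right : DualPair.paramFilterAt B Φ x₀ ≤ DualPair.paramFilter B Φ x₀)
    (DualPair.scaledSubdiff B Φ)
  have hsup := hΦ.upperLimit_subset_normalCone (B := B) hx₀
  exact ⟨hsub.antisymm (hmono.trans hsup),
    fun ξ hξ => DualPair.exists_net_of_mem_upperLimit (hsub hξ),
    (hsub.trans hmono).antisymm hsup⟩
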